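/- A graphon is a bounded symmetric Lebesgue measurable function $W:[0,1]^2\to\mathbb R$; let $\mathcal W$ be the set of all graphons. For a finite simple graph $F=(V,E)$ put $$t(F,W)=\int_{[0,1]^V}\prod_{ij\in E}W(x_i,x_j)\prod_{i\in V}dx_i .$$ Two graphons $U,W$ are weakly isomorphic if $t(F,U)=t(F,W)$ for every finite simple graph $F$. A graphon $W$ is finitely forcible in $\mathcal W$ if there are finitely many finite simple graphs $F_1,\dots,F_k$ such that every $U\in\mathcal W$ with $t(F_i,U)=t(F_i,W)$ for $i=1,\dots,k$ is weakly isomorphic to $W$. Let $\widehat C_4$ be the 4-cycle with all four nodes labeled, two opposite edges colored blue and the other two colored red, and $$t^4(\widehat C_4,U)(x_1,x_2,x_3,x_4)=U(x_1,x_2)\,(1-U(x_2,x_3))\,U(x_3,x_4)\,(1-U(x_4,x_1)).$$ **Theorem.** Let $p$ be a real symmetric polynomial in two variables whose restriction to $[0,1]^2$ is monotone decreasing (that is, weakly decreasing in each variable), and let $W(x,y)=\mathbf 1_{p(x,y)\ge 0}$ on $[0,1]^2$. Then $W$ is finitely forcible in $\mathcal W$. Moreover, $t^4(\widehat C_4,W)=0$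 almost everywhere, and every $U\in\mathcal W$ with $$t^4(\widehat C_4,U)=0 \text{ almost everywhere on } [0,1]^4,\qquad t(K_{a,b},U)=t(K_{a,b},W)\quad (0\le a,b\le \deg p+1)$$ is weakly isomorphic to $W$. Here $\deg p$ is the total degree, and $\deg 0=0$. In particular, the half-graphon $W_h(x,y)=\mathbf 1_{x+y\le 1}$ is finitely forcible in $\mathcal W$. -/

import Mathlib

open MeasureTheory unitInterval

/-- A graphon: a bounded symmetric (Lebesgue) measurable function `[0,1]² → ℝ`.  The type `Graphon`
is the class `𝒲`.  Lebesgue measurability is expressed by `AEMeasurable` with respect to the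
Lebesgue measure on `[0,1]²`. -/
structure Graphon where
  toFun : I → I → ℝ
  symm' : ∀ x y, toFun x y = toFun y x
  bounded' : ∃ C : ℝ, ∀ x y, |toFun x y| ≤ C
  aemeasurable' : AEMeasurable (fun z : I × I => toFun z.1 z.2) volume

/-- A 2-edge-colored graph on the node set `V`: the edge set is partitioned into the blue edges and
the red edges. -/
structure TwoEdgeColoredGraph (V : Type*) where
  blue : SimpleGraph V
  red : SimpleGraph V
  disjoint' : Disjoint blue red

namespace Graphon

instance : CoeFun Graphon (fun _ => I → I → ℝ) := ⟨Graphon.toFun⟩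

/-- The value `W (x i) (x j)` at the unordered pair `ij`. -/
def edgeVal (W : Graphon) {V : Type*} (x : V → I) : Sym2 V → ℝ :=
  Sym2.lift ⟨fun i j => W (x i) (x j), fun i j => W.symm' (x i) (x j)⟩

open Classical in
/-- The subgraph density `t(F, W) = ∫_{[0,1]^V} ∏_{ij ∈ E(F)} W(x_i, x_j) ∏ dx_i` of a finite simple
graph `F`. -/
noncomputable def density {V : Type*} [Fintype V] (F : SimpleGraph V) (W : Graphon) : ℝ :=
  ∫ x : V → I, ∏ e ∈ F.edgeFinset, W.edgeVal x e

open Classical in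
/-- The function `t^k(F, W) : [0,1]^V → ℝ` of a 2-edge-colored graph `F` all of whose `k = |V|` nodes
are labeled: the product of `W(x_i, x_j)` over the blue edges and of `1 - W(x_i, x_j)` over the red
edges. -/
noncomputable def labeledDensity {V : Type*} [Fintype V] (F : TwoEdgeColoredGraph V) (W : Graphon)
    (x : V → I) : ℝ :=
  (∏ e ∈ F.blue.edgeFinset, W.edgeVal x e) * ∏ e ∈ F.red.edgeFinset, (1 - W.edgeVal x e)

/-- Two graphons are weakly isomorphic if every finite simple graph has the same density in both. -/
def WeaklyIsomorphic (U W : Graphon) : Prop :=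
  ∀ (n : ℕ) (F : SimpleGraph (Fin n)), density F U = density F W

/-- `W` is finitely forcible in the class `A` of graphons: `W ∈ A`, and there are finitely many
finite simple graphs whose densities determine `W` within `A`, up to weak isomorphism. -/
def FinitelyForcibleIn (A : Set Graphon) (W : Graphon) : Prop :=
  W ∈ A ∧ ∃ (k : ℕ) (n : Fin k → ℕ) (F : ∀ i, SimpleGraph (Fin (n i))),
    ∀ U ∈ A, (∀ i, density (F i) U = density (F i) W) → WeaklyIsomorphic U W

/-- The 4-cycle on the labeled nodes `0, 1, 2, 3`, with two opposite edges blue and the other two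
red. -/
def coloredC4 : TwoEdgeColoredGraph (Fin 4) where
  blue := SimpleGraph.fromEdgeSet {s(0, 1), s(2, 3)}
  red := SimpleGraph.fromEdgeSet {s(1, 2), s(3, 0)}
  disjoint' := by
    rw [SimpleGraph.disjoint_left]
    intro a b
    simp only [SimpleGraph.fromEdgeSet_adj, Set.mem_insert_iff, Set.mem_singleton_iff]
    revert a b
    decide

open Classical in
/-- The 0-1 valued graphon `W(x, y) = 1_{p(x, y) ≥ 0}` of a symmetric polynomial `p`. -/
noncomputable def ofPolynomial (p : MvPolynomial (Fin 2) ℝ) (hp : p.IsSymmetric) : Graphon where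
  toFun x y := if 0 ≤ MvPolynomial.eval ![(x : ℝ), (y : ℝ)] p then 1 else 0
  symm' x y := by
    have h : MvPolynomial.eval ![(x : ℝ), (y : ℝ)] p = MvPolynomial.eval ![(y : ℝ), (x : ℝ)] p := by
      conv_lhs => rw [← hp (Equiv.swap 0 1)]
      rw [MvPolynomial.eval_rename]
      congr 2
      funext i
      fin_cases i <;> simp
    simp only [h]
  bounded' := ⟨1, fun x y => by split_ifs <;> simp⟩
  aemeasurable' := by
    refine (Measurable.ite ?_ measurable_const measurable_const).aemeasurable
    refine measurableSet_le measurable_const (Continuous.measurable ?_)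
    refine (MvPolynomial.continuous_eval p).comp (continuous_pi fun i => ?_)
    fin_cases i
    · exact continuous_subtype_val.comp continuous_fst
    · exact continuous_subtype_val.comp continuous_snd

open Classical in
/-- The half-graphon `1_{x + y ≤ 1}`. -/
noncomputable def half : Graphon where
  toFun x y := if (x : ℝ) + y ≤ 1 then 1 else 0
  symm' x y := by simp only [add_comm]
  bounded' := ⟨1, fun x y => by split_ifs <;> simp⟩
  aemeasurable' := by
    refine (Measurable.ite ?_ measurable_const measurable_const).aemeasurable
    refine measurableSet_le (Continuous.measurable ?_) measurable_const
    fun_prop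

end Graphon

/-! Suppose that for almost all `x, x'` one of `U x y * (1 - U x' y)`, `U x' y * (1 - U x y)`
vanishes for almost every `y` (`IsNested`). Then `U` is 0-1 valued a.e. with neighbourhoods forming
a chain, and rearranging the points by decreasing degree turns `U` into the indicator of a lower set
`S` of the square (`exists_isLowerSet_of_nested`). For a lower set only the largest vertex on each
side of `K_{a+1,b+1}` matters, so its density is a constant times the moment of `x^a y^b` over `S`
(`density_completeBipartiteGraph_ofSet`). The prescribed densities thus fix the volume of `S` and
the integral of `p` over `S`. Since `T = {p ≥ 0}` maximises the integral of `p`, equality gives `S =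
T` a.e. (`ae_eq_of_setIntegral_eq`).

For fixed opposite nodes the coloured 4-cycle is a product of a function of each remaining node, so
its vanishing a.e. is nestedness. Its integral cannot replace this in `𝒲`: values outside `[0,1]`
allow cancellation. A nonnegative quantity, `starDefect`, is used instead. Its integral is a signed
sum of densities of simple graphs. Its vanishing says that the common degree of `n` points equals
the degree of one of them; a density argument in `L¹` carries this to coinciding points, where `n =
2, 3, 4` force values in `{0,1}`, and `n = 2` then gives nestedness. -/

namespace Graphon

/-! ### Densities: null sets, relabelling, bipartite graphs -/

theorem measurePreserving_pair {V : Type*} [Fintype V] {i j : V} (hij : i ≠ j) :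
    MeasurePreserving (fun x : V → I => (x i, x j)) volume volume := by
  have hind := ProbabilityTheory.iIndepFun_pi (μ := fun _ : V => (volume : Measure I))
    (X := fun _ => (id : I → I)) (fun _ => aemeasurable_id)
  have hp : ProbabilityTheory.IndepFun (fun x : V → I => x i) (fun x : V → I => x j)
      (Measure.pi fun _ => volume) := hind.indepFun hij
  have hi : ∀ k : V, Measurable fun x : V → I => x k := fun k => measurable_pi_apply k
  rw [ProbabilityTheory.indepFun_iff_map_prod_eq_prod_map_map (hi i).aemeasurable
    (hi j).aemeasurable] at hp
  refine ⟨(hi i).prodMk (hi j), ?_⟩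
  have hm : ∀ k : V, Measure.map (fun x : V → I => x k) (Measure.pi fun _ => volume) = volume :=
    fun k => (measurePreserving_eval (fun _ : V => (volume : Measure I)) k).map_eq
  refine hp.trans ?_
  rw [hm i, hm j]
  rfl

theorem edgeVal_mk (W : Graphon) {V : Type*} (x : V → I) (i j : V) :
    W.edgeVal x s(i, j) = W (x i) (x j) := rfl

theorem density_congr_ae {U W : Graphon} (h : ∀ᵐ z : I × I, U z.1 z.2 = W z.1 z.2)
    {V : Type*} [Fintype V] (F : SimpleGraph V) : density F U = density F W := by
  classical
  refine integral_congr_ae ?_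
  have : ∀ᵐ x : V → I, ∀ e ∈ F.edgeFinset, U.edgeVal x e = W.edgeVal x e := by
    refine (Finset.eventually_all _).2 fun e he => ?_
    induction e with
    | _ i j =>
      have hij : i ≠ j := by
        rw [SimpleGraph.mem_edgeFinset, SimpleGraph.mem_edgeSet] at he
        exact he.ne
      exact (measurePreserving_pair hij).quasiMeasurePreserving.ae h
  filter_upwards [this] with x hx
  exact Finset.prod_congr rfl hx

theorem weaklyIsomorphic_of_ae {U W : Graphon} (h : ∀ᵐ z : I × I, U z.1 z.2 = W z.1 z.2) :
    WeaklyIsomorphic U W := fun _ F => density_congr_ae h F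

theorem WeaklyIsomorphic.trans {U V W : Graphon} (h : WeaklyIsomorphic U V)
    (h' : WeaklyIsomorphic V W) : WeaklyIsomorphic U W := fun n F => (h n F).trans (h' n F)

theorem density_of_iso {V V' : Type*} [Fintype V] [Fintype V'] {F : SimpleGraph V}
    {F' : SimpleGraph V'} (e : F ≃g F') (U : Graphon) : density F U = density F' U := by
  classical
  have hmp := volume_measurePreserving_piCongrLeft (fun _ : V' => I) e.toEquiv
  unfold density
  rw [← hmp.integral_comp (MeasurableEquiv.measurableEmbedding _)]
  refine integral_congr_ae (Filter.Eventually.of_forall fun x => ?_)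
  refine Finset.prod_nbij' (Sym2.map e) (Sym2.map e.symm) ?_ ?_ ?_ ?_ ?_
  · intro d hd
    induction d with
    | _ i j =>
      simp only [SimpleGraph.mem_edgeFinset, SimpleGraph.mem_edgeSet, Sym2.map_mk] at hd ⊢
      exact e.map_adj_iff.2 hd
  · intro d hd
    induction d with
    | _ i j =>
      simp only [SimpleGraph.mem_edgeFinset, SimpleGraph.mem_edgeSet, Sym2.map_mk] at hd ⊢
      exact e.symm.map_adj_iff.2 hd
  · intro d _
    induction d with
    | _ i j => simp
  · intro d _
    induction d with
    | _ i j => simp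
  · intro d _
    induction d with
    | _ i j =>
      rw [Sym2.map_mk, edgeVal_mk, edgeVal_mk]
      have h : ∀ k, (MeasurableEquiv.piCongrLeft (fun _ : V' => I) e.toEquiv) x (e k) = x k :=
        fun k => Equiv.piCongrLeft_apply_apply (fun _ : V' => I) e.toEquiv x k
      rw [h, h]

/-- The bipartite graph of a relation. -/
def bipartiteGraph {A B : Type*} (R : A → B → Prop) : SimpleGraph (A ⊕ B) where
  Adj
    | .inl a, .inr b => R a b
    | .inr b, .inl a => R a b
    | _, _ => False
  symm := ⟨by rintro (a | b) (a' | b') h <;> exact h⟩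
  loopless := ⟨by rintro (a | b) h <;> exact h⟩

theorem completeBipartiteGraph_eq (A B : Type*) :
    completeBipartiteGraph A B = bipartiteGraph fun (_ : A) (_ : B) => True := by
  ext u v
  rcases u with a | b <;> rcases v with a' | b' <;> simp [bipartiteGraph]

open Classical in
theorem prod_edgeVal_bipartiteGraph {A B : Type*} [Fintype A] [Fintype B] (R : A → B → Prop)
    (U : Graphon) (x : A ⊕ B → I) :
    ∏ e ∈ (bipartiteGraph R).edgeFinset, U.edgeVal x e =
      ∏ b, ∏ a, if R a b then U (x (.inl a)) (x (.inr b)) else 1 := by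
  rw [← Finset.prod_product', ← Finset.prod_filter]
  symm
  refine Finset.prod_bij (fun z _ => s(.inl z.2, .inr z.1)) ?_ ?_ ?_ ?_
  · rintro ⟨b, a⟩ h
    rw [SimpleGraph.mem_edgeFinset, SimpleGraph.mem_edgeSet]
    exact (Finset.mem_filter.1 h).2
  · rintro ⟨b, a⟩ _ ⟨b', a'⟩ _ h
    simp only [Sym2.eq_iff] at h
    simp_all
  · intro e he
    induction e with
    | _ u v =>
      rw [SimpleGraph.mem_edgeFinset, SimpleGraph.mem_edgeSet] at he
      rcases u with a | b <;> rcases v with a' | b'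
      · exact he.elim
      · exact ⟨(b', a), Finset.mem_filter.2 ⟨Finset.mem_univ _, he⟩, rfl⟩
      · exact ⟨(b, a'), Finset.mem_filter.2 ⟨Finset.mem_univ _, he⟩, Sym2.eq_swap⟩
      · exact he.elim
  · rintro ⟨b, a⟩ _
    rfl

-- Once the points on the `A` side are fixed, the points on the `B` side are independent, so Fubini
-- factors the inner integral.
open Classical in
theorem density_bipartiteGraph {A B : Type*} [Fintype A] [Fintype B] (R : A → B → Prop)
    (U : Graphon) (hU : Measurable fun z : I × I => U z.1 z.2) :
    density (bipartiteGraph R) U =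
      ∫ x : A → I, ∏ b, ∫ y : I, ∏ a, if R a b then U (x a) y else 1 := by
  obtain ⟨C, hC⟩ := U.bounded'
  have hmp := volume_measurePreserving_sumPiEquivProdPi (fun _ : A ⊕ B => I)
  let f : (A → I) × (B → I) → ℝ := fun z => ∏ b, ∏ a, if R a b then U (z.1 a) (z.2 b) else 1
  have hfm : Measurable f := by
    refine Finset.measurable_prod _ fun b _ => Finset.measurable_prod _ fun a _ => ?_
    split_ifs
    · exact hU.comp (g := fun z : I × I => U z.1 z.2)
        (f := fun z : (A → I) × (B → I) => (z.1 a, z.2 b)) (by fun_prop)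
    · exact measurable_const
  have hfi : Integrable f (volume.prod volume) := by
    refine Integrable.of_bound hfm.aestronglyMeasurable
      (∏ b : B, ∏ a : A, max C 1) (Filter.Eventually.of_forall fun z => ?_)
    simp only [f, norm_prod]
    refine Finset.prod_le_prod (fun b _ => Finset.prod_nonneg fun a _ => norm_nonneg _)
      fun b _ => Finset.prod_le_prod (fun a _ => norm_nonneg _) fun a _ => ?_
    split_ifs
    · exact (hC _ _).trans (le_max_left _ _)
    · simp
  have h1 : density (bipartiteGraph R) U = ∫ z, f z := by
    rw [← hmp.integral_comp (MeasurableEquiv.measurableEmbedding _)]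
    refine integral_congr_ae (Filter.Eventually.of_forall fun x => ?_)
    exact prod_edgeVal_bipartiteGraph R U x
  rw [h1]
  refine (integral_prod f hfi).trans ?_
  refine integral_congr_ae (Filter.Eventually.of_forall fun x => ?_)
  exact integral_fintype_prod_volume_eq_prod
    (fun (b : B) (y : I) => ∏ a, if R a b then U (x a) y else 1)

/-- Symmetrising and truncating a measurable version keeps it a graphon and changes it only on a
null set. Every section of the new graphon is measurable. -/
theorem exists_measurable_ae_eq (U : Graphon) :
    ∃ U' : Graphon, (Measurable fun z : I × I => U' z.1 z.2) ∧
      ∀ᵐ z : I × I, U z.1 z.2 = U' z.1 z.2 := by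
  obtain ⟨C, hC⟩ := U.bounded'
  have hC0 : 0 ≤ C := (abs_nonneg _).trans (hC 0 0)
  let m := U.aemeasurable'.mk
  have hm : Measurable m := U.aemeasurable'.measurable_mk
  let g : I × I → ℝ := fun z => max (-C) (min C ((m z + m z.swap) / 2))
  have hg : Measurable g :=
    measurable_const.max (measurable_const.min
      ((hm.add (hm.comp measurable_swap)).div_const 2))
  refine ⟨⟨fun x y => g (x, y), fun x y => ?_, ⟨C, fun x y => ?_⟩, hg.aemeasurable⟩, hg, ?_⟩
  · simp only [g, Prod.swap_prod_mk, add_comm]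
  · rw [abs_le]
    exact ⟨le_max_left _ _, max_le (by linarith) (min_le_left _ _)⟩
  · have h1 : ∀ᵐ z : I × I, U z.1 z.2 = m z := U.aemeasurable'.ae_eq_mk
    have h2 : ∀ᵐ z : I × I, U z.swap.1 z.swap.2 = m z.swap :=
      (Measure.measurePreserving_swap (μ := (volume : Measure I))
        (ν := (volume : Measure I))).quasiMeasurePreserving.ae h1
    filter_upwards [h1, h2] with z hz hz'
    have hs : U z.swap.1 z.swap.2 = U z.1 z.2 := U.symm' _ _
    have hb := abs_le.1 (hC z.1 z.2)
    simp only [g, ← hz, ← hz', hs, add_self_div_two]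
    rw [min_eq_right hb.2, max_eq_right hb.1]

end Graphon

/-! ### Monotone rearrangement of nested neighbourhoods -/

/-- A probability measure on `[0, ∞]` is the distribution of a decreasing function on `[0, 1]`. -/
theorem exists_antitone_map_volume_eq (ν : Measure ENNReal) [IsProbabilityMeasure ν] :
    ∃ q : I → ENNReal, Antitone q ∧ Measure.map q volume = ν ∧
      ∀ u : I, ENNReal.ofReal u ≤ ν (Set.Ici (q u)) := by
  let S : I → Set ENNReal := fun u => {t | ENNReal.ofReal u ≤ ν (Set.Ici t)}
  have h0 : ∀ u, (0 : ENNReal) ∈ S u := fun u => by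
    have : Set.Ici (0 : ENNReal) = Set.univ := by ext; simp
    simp only [S, Set.mem_ofPred_eq, this, measure_univ]
    exact ENNReal.ofReal_le_one.2 u.2.2
  -- The supremum is attained because `t ↦ ν (Ici t)` is continuous from the left.
  have hmem : ∀ u, sSup (S u) ∈ S u := fun u => by
    obtain ⟨t, htm, ht, hts⟩ := exists_seq_tendsto_sSup ⟨0, h0 u⟩ (OrderTop.bddAbove (S u))
    have hI : Set.Ici (sSup (S u)) = ⋂ n, Set.Ici (t n) := by
      ext s
      simp only [Set.mem_Ici, Set.mem_iInter]
      exact ⟨fun hs n => (le_sSup (hts n)).trans hs,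
        fun hs => le_of_tendsto' ht hs⟩
    have hlim := tendsto_measure_iInter_atTop (μ := ν) (s := fun n => Set.Ici (t n))
      (fun n => measurableSet_Ici.nullMeasurableSet)
      (fun m n hmn => Set.Ici_subset_Ici.2 (htm hmn)) ⟨0, measure_ne_top _ _⟩
    rw [← hI] at hlim
    exact ge_of_tendsto' hlim hts
  -- Galois connection for the quantile function: preimages of `Ici t` are initial intervals of
  -- length `ν (Ici t)`.
  have hgal : ∀ u t, t ≤ sSup (S u) ↔ ENNReal.ofReal u ≤ ν (Set.Ici t) := fun u t =>
    ⟨fun h => (hmem u).trans (measure_mono (Set.Ici_subset_Ici.2 h)), fun h => le_sSup h⟩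
  have hanti : Antitone fun u => sSup (S u) := fun u v huv =>
    sSup_le_sSup fun t ht => (ENNReal.ofReal_le_ofReal huv).trans ht
  refine ⟨fun u => sSup (S u), hanti, ?_, hmem⟩
  have hq : Measurable fun u => sSup (S u) := hanti.measurable
  have := Measure.isProbabilityMeasure_map (μ := (volume : Measure I)) hq.aemeasurable
  refine Measure.ext_of_Ici _ _ fun t => ?_
  rw [Measure.map_apply hq measurableSet_Ici]
  have hle : ν (Set.Ici t) ≤ 1 := prob_le_one
  have hne : ν (Set.Ici t) ≠ ⊤ := measure_ne_top _ _
  have : (fun u => sSup (S u)) ⁻¹' Set.Ici t =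
      Set.Iic (⟨(ν (Set.Ici t)).toReal, ENNReal.toReal_nonneg,
        ENNReal.toReal_le_of_le_ofReal zero_le_one (by simpa using hle)⟩ : I) := by
    ext u
    simp only [Set.mem_preimage, Set.mem_Ici, Set.mem_Iic, hgal]
    rw [ENNReal.ofReal_le_iff_le_toReal hne]
    rfl
  rw [this, unitInterval.volume_Iic, ENNReal.ofReal_toReal hne]

namespace Graphon

open Classical in
/-- The 0-1 valued graphon of a symmetric measurable set. -/
noncomputable def ofSet (S : Set (I × I)) (hS : MeasurableSet S)
    (hsymm : ∀ x y, (x, y) ∈ S → (y, x) ∈ S) : Graphon where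
  toFun x y := if (x, y) ∈ S then 1 else 0
  symm' x y := by simp only [show (x, y) ∈ S ↔ (y, x) ∈ S from ⟨hsymm x y, hsymm y x⟩]
  bounded' := ⟨1, fun x y => by split_ifs <;> simp⟩
  aemeasurable' := (Measurable.ite hS measurable_const measurable_const).aemeasurable

theorem ofSet_apply {S : Set (I × I)} (hS : MeasurableSet S)
    (hsymm : ∀ x y, (x, y) ∈ S → (y, x) ∈ S) (x y : I) [Decidable ((x, y) ∈ S)] :
    ofSet S hS hsymm x y = if (x, y) ∈ S then 1 else 0 := by
  dsimp only [ofSet]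
  congr

/-- A density depends on `f` only through its law: it is the integral of one fixed kernel product
against a power of that law. -/
theorem density_eq_of_map_eq {X : Type*} [MeasurableSpace X] {k : X → X → ℝ}
    (hk : Measurable fun z : X × X => k z.1 z.2) (hsymm : ∀ s t, k s t = k t s) {f h : I → X}
    (hf : Measurable f) (hh : Measurable h)
    (hmap : Measure.map f volume = Measure.map h volume) {U W : Graphon}
    (hU : ∀ x y, U x y = k (f x) (f y)) (hW : ∀ x y, W x y = k (h x) (h y))
    {V : Type*} [Fintype V] (F : SimpleGraph V) : density F U = density F W := by
  classical
  let κ : Sym2 V → (V → X) → ℝ := fun e s =>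
    Sym2.lift ⟨fun i j => k (s i) (s j), fun i j => hsymm (s i) (s j)⟩ e
  have hκ : ∀ e, Measurable (κ e) := by
    intro e
    induction e with
    | _ i j =>
      have hp : Measurable fun s : V → X => (s i, s j) := by fun_prop
      exact hk.comp hp
  have key : ∀ (g : I → X), Measurable g → ∀ Y : Graphon, (∀ x y, Y x y = k (g x) (g y)) →
      density F Y =
        ∫ s, ∏ e ∈ F.edgeFinset, κ e s ∂Measure.pi fun _ : V => Measure.map g volume := by
    intro g hg Y hY
    have := Measure.isProbabilityMeasure_map (μ := (volume : Measure I)) hg.aemeasurable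
    have hgm : Measurable fun (x : V → I) i => g (x i) :=
      measurable_pi_lambda _ fun i => hg.comp (measurable_pi_apply i)
    rw [← Measure.pi_map_pi (fun _ => hg.aemeasurable), integral_map hgm.aemeasurable
      (Finset.measurable_prod _ fun e _ => hκ e).aestronglyMeasurable]
    refine integral_congr_ae (Filter.Eventually.of_forall fun x => ?_)
    refine Finset.prod_congr rfl fun e _ => ?_
    induction e with
    | _ i j => exact hY _ _
  rw [key f hf U hU, key h hh W hW, hmap]

/-- With `d` the degree and `G t` the measure of `{d ≥ t}`, nestedness makes `E` a.e. equal to `{G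
(d y) ≤ d x}`, a kernel in the degrees alone. Replacing `d` by its decreasing rearrangement `q`
keeps the law and yields a lower set. -/
theorem exists_isLowerSet_of_nested {E : Set (I × I)} (hE : MeasurableSet E)
    (hsymm : ∀ x y, (x, y) ∈ E → (y, x) ∈ E)
    (hnest : ∀ᵐ z : I × I, volume (Prod.mk z.1 ⁻¹' E \ Prod.mk z.2 ⁻¹' E) = 0 ∨
      volume (Prod.mk z.2 ⁻¹' E \ Prod.mk z.1 ⁻¹' E) = 0) :
    ∃ (S : Set (I × I)) (hS : MeasurableSet S) (hsymmS : ∀ x y, (x, y) ∈ S → (y, x) ∈ S),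
      IsLowerSet S ∧ WeaklyIsomorphic (ofSet E hE hsymm) (ofSet S hS hsymmS) := by
  let N : I → Set I := fun x => Prod.mk x ⁻¹' E
  have hN : ∀ x, MeasurableSet (N x) := fun x => measurable_prodMk_left hE
  let d : I → ENNReal := fun x => volume (N x)
  have hd : Measurable d := measurable_measure_prodMk_left hE
  have hdfin : ∀ x, d x ≠ ⊤ := fun x => measure_ne_top _ _
  -- neighbourhoods are ordered by their measure
  have hA : ∀ᵐ z : I × I, ∀ᵐ x : I, d z.1 ≤ d z.2 → (z.1, x) ∈ E → (z.2, x) ∈ E := by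
    filter_upwards [hnest] with z hz
    by_cases hle : d z.1 ≤ d z.2
    · have h0 : volume (N z.1 \ N z.2) = 0 := by
        rcases hz with hz | hz
        · exact hz
        · have h1 := measure_inter_add_sdiff (μ := volume) (N z.2) (hN z.1)
          have h2 := measure_inter_add_sdiff (μ := volume) (N z.1) (hN z.2)
          rw [show volume (N z.2 \ N z.1) = 0 from hz, add_zero, Set.inter_comm] at h1
          rw [h1] at h2
          have h3 : d z.2 + volume (N z.1 \ N z.2) ≤ d z.2 + 0 := by
            rw [add_zero]
            exact h2.le.trans hle
          exact le_antisymm ((ENNReal.add_le_add_iff_left (hdfin _)).1 h3) zero_le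
      rw [ae_iff]
      refine measure_mono_null (fun x hx => ?_) h0
      simp only [Set.mem_ofPred_eq, not_forall] at hx
      obtain ⟨_, h1, h2⟩ := hx
      exact ⟨h1, h2⟩
    · exact Filter.Eventually.of_forall fun x h => absurd h hle
  -- By symmetry of `E`, the previous fact says that a neighbour `y` of `x` may be exchanged for
  -- almost any point of at least the same degree.
  have hB : ∀ᵐ z : I × I, ∀ᵐ y' : I, d z.2 ≤ d y' → (z.1, z.2) ∈ E → (z.1, y') ∈ E := by
    have hm : MeasurableSet {w : (I × I) × I |
        d w.1.1 ≤ d w.1.2 → (w.1.1, w.2) ∈ E → (w.1.2, w.2) ∈ E} := by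
      have e1 : MeasurableSet {w : (I × I) × I | d w.1.1 ≤ d w.1.2} :=
        measurableSet_le (by fun_prop) (by fun_prop)
      have e2 : MeasurableSet {w : (I × I) × I | (w.1.1, w.2) ∈ E} :=
        (show Measurable fun w : (I × I) × I => (w.1.1, w.2) by fun_prop) hE
      have e3 : MeasurableSet {w : (I × I) × I | (w.1.2, w.2) ∈ E} :=
        (show Measurable fun w : (I × I) × I => (w.1.2, w.2) by fun_prop) hE
      exact e1.imp (e2.imp e3)
    have h1 := (Measure.ae_prod_iff_ae_ae (μ := (volume : Measure (I × I)))
      (ν := (volume : Measure I)) hm).2 hA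
    have h2 := ((Measure.measurePreserving_swap (μ := (volume : Measure I))
        (ν := (volume : Measure (I × I)))).comp
      (measurePreserving_prodAssoc (volume : Measure I) (volume : Measure I)
        (volume : Measure I))).quasiMeasurePreserving.ae h1
    filter_upwards [Measure.ae_ae_of_ae_prod h2] with z hz
    filter_upwards [hz] with y' hy' hle hmem
    exact hsymm _ _ (hy' hle (hsymm _ _ hmem))
  let G : ENNReal → ENNReal := fun t => Measure.map d volume (Set.Ici t)
  have hG : Antitone G := fun s t hst => measure_mono (Set.Ici_subset_Ici.2 hst)
  have hGd : ∀ t, G t = volume {y | t ≤ d y} := fun t => Measure.map_apply hd measurableSet_Ici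
  have hprob := Measure.isProbabilityMeasure_map (μ := (volume : Measure I)) hd.aemeasurable
  obtain ⟨q, hq, hqmap, hqG⟩ := exists_antitone_map_volume_eq (Measure.map d volume)
  -- Probability integral transform, checked on `q`, which has the same law as `d` and satisfies `u
  -- ≤ G (q u)`.
  have hGle : ∀ c, volume {y | G (d y) ≤ c} ≤ c := fun c => by
    have hT : MeasurableSet {t | G t ≤ c} := measurableSet_le hG.measurable measurable_const
    calc volume {y | G (d y) ≤ c} = Measure.map d volume {t | G t ≤ c} :=
          (Measure.map_apply hd hT).symm
      _ = volume (q ⁻¹' {t | G t ≤ c}) := by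
          rw [← hqmap, Measure.map_apply hq.measurable hT]
      _ ≤ c := by
          rcases le_or_gt 1 c with h1 | h1
          · exact prob_le_one.trans h1
          · have hcr : c ≠ ⊤ := (h1.trans ENNReal.one_lt_top).ne
            refine (measure_mono (t := Set.Iic (⟨c.toReal, ENNReal.toReal_nonneg,
              ENNReal.toReal_le_of_le_ofReal zero_le_one (by simpa using h1.le)⟩ : I))
              fun u hu => ?_).trans ?_
            · exact (ENNReal.ofReal_le_iff_le_toReal hcr).1 ((hqG u).trans hu)
            · rw [unitInterval.volume_Iic, ENNReal.ofReal_toReal hcr]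
  have hmG : MeasurableSet {z : I × I | G (d z.2) ≤ d z.1} :=
    measurableSet_le (hG.measurable.comp (hd.comp measurable_snd)) (hd.comp measurable_fst)
  have hmG' : MeasurableSet {z : I × I | G (d z.1) ≤ d z.2} :=
    measurableSet_le (hG.measurable.comp (hd.comp measurable_fst)) (hd.comp measurable_snd)
  have hsub : ∀ᵐ x : I, ∀ᵐ y : I, (x, y) ∈ E → G (d y) ≤ d x := by
    refine Measure.ae_ae_of_ae_prod (p := fun z : I × I => z ∈ E → G (d z.2) ≤ d z.1) ?_
    filter_upwards [hB] with z hz hzE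
    rw [hGd]
    refine measure_mono_ae ?_
    filter_upwards [hz] with y' hy' hle
    exact hy' hle hzE
  have heq : ∀ᵐ z : I × I, z ∈ E ↔ G (d z.2) ≤ d z.1 := by
    refine (Measure.ae_prod_iff_ae_ae (hE.iff hmG)).2 ?_
    filter_upwards [hsub] with x hx
    -- The neighbourhood of `x` has measure `d x` and is a.e. contained in a set of measure at most
    -- `d x`, so the two agree.
    have := ae_eq_of_ae_subset_of_measure_ge (μ := volume) (s := N x)
      (t := {y | G (d y) ≤ d x}) hx (hGle _) (hN x).nullMeasurableSet (measure_ne_top _ _)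
    filter_upwards [this] with y hy
    exact hy.to_iff
  -- Both inequalities are kept so that the new set is symmetric everywhere, not just a.e.
  have heq' : ∀ᵐ z : I × I, z ∈ E ↔ G (d z.2) ≤ d z.1 ∧ G (d z.1) ≤ d z.2 := by
    have hsw := (Measure.measurePreserving_swap (μ := (volume : Measure I))
      (ν := (volume : Measure I))).quasiMeasurePreserving.ae heq
    filter_upwards [heq, hsw] with z hz hz'
    have hzs : z ∈ E ↔ z.swap ∈ E := ⟨hsymm _ _, hsymm _ _⟩
    refine ⟨fun h => ⟨hz.1 h, hz'.1 (hzs.1 h)⟩, fun h => hz.2 h.1⟩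
  let D : Set (I × I) := {z | G (d z.2) ≤ d z.1 ∧ G (d z.1) ≤ d z.2}
  have hD : MeasurableSet D := hmG.inter hmG'
  have hqm := hq.measurable
  let S : Set (I × I) := {z | G (q z.2) ≤ q z.1 ∧ G (q z.1) ≤ q z.2}
  have hS : MeasurableSet S :=
    (measurableSet_le (hG.measurable.comp (hqm.comp measurable_snd))
      (hqm.comp measurable_fst)).inter
    (measurableSet_le (hG.measurable.comp (hqm.comp measurable_fst))
      (hqm.comp measurable_snd))
  have hDs : ∀ x y, (x, y) ∈ D → (y, x) ∈ D := fun x y h => ⟨h.2, h.1⟩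
  have hSs : ∀ x y, (x, y) ∈ S → (y, x) ∈ S := fun x y h => ⟨h.2, h.1⟩
  refine ⟨S, hS, hSs, ?_, ?_⟩
  · rintro z w hwz ⟨h1, h2⟩
    exact ⟨(hG (hq hwz.2)).trans (h1.trans (hq hwz.1)),
      (hG (hq hwz.1)).trans (h2.trans (hq hwz.2))⟩
  · refine (weaklyIsomorphic_of_ae (W := ofSet D hD hDs) ?_).trans fun n F => ?_
    · filter_upwards [heq'] with z hz
      classical
      rw [ofSet_apply, ofSet_apply]
      exact if_congr hz rfl rfl
    · classical
      let k : ENNReal → ENNReal → ℝ := fun s t => if G t ≤ s ∧ G s ≤ t then 1 else 0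
      refine density_eq_of_map_eq (k := k) ?_ (fun s t => if_congr and_comm rfl rfl) hd hqm
        hqmap.symm (fun x y => ofSet_apply hD hDs x y) (fun x y => ofSet_apply hS hSs x y) F
      refine Measurable.ite ?_ measurable_const measurable_const
      exact (measurableSet_le (hG.measurable.comp measurable_snd) measurable_fst).inter
        (measurableSet_le (hG.measurable.comp measurable_fst) measurable_snd)

end Graphon

/-! ### Complete bipartite densities of lower sets as moments -/

/-- The maximum of the coordinates of a point of the cube. -/
noncomputable def maxCoord {n : ℕ} (x : Fin (n + 1) → I) : I :=
  Finset.univ.sup' Finset.univ_nonempty x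

theorem measurable_maxCoord {n : ℕ} : Measurable (maxCoord (n := n)) := by
  have : (maxCoord (n := n)) =
      Finset.univ.sup' Finset.univ_nonempty fun i (x : Fin (n + 1) → I) => x i := by
    ext x
    simp [maxCoord, Finset.sup'_apply]
  rw [this]
  exact Finset.measurable_sup' _ fun i _ => measurable_pi_apply i

theorem IsLowerSet.maxCoord_mem_iff {T : Set I} (hT : IsLowerSet T) {n : ℕ}
    (x : Fin (n + 1) → I) : maxCoord x ∈ T ↔ ∀ i, x i ∈ T := by
  obtain ⟨i, _, hi⟩ := Finset.exists_mem_eq_sup' Finset.univ_nonempty x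
  refine ⟨fun h j => hT (Finset.le_sup' x (Finset.mem_univ j)) h, fun h => ?_⟩
  rw [maxCoord, hi]
  exact h i

theorem setLIntegral_Iic_pow (n : ℕ) (t : I) :
    ∫⁻ s in Set.Iic t, ENNReal.ofReal ((n + 1) * (s : ℝ) ^ n) = ENNReal.ofReal t ^ (n + 1) := by
  have h1 := measurePreserving_coe.setLIntegral_comp_preimage
    (measurableSet_Iic (a := (t : ℝ)))
    (f := fun s : ℝ => ENNReal.ofReal ((n + 1) * s ^ n)) (by fun_prop)
  have h2 : ((↑) : I → ℝ) ⁻¹' Set.Iic (t : ℝ) = Set.Iic t := by ext; simp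
  have h3 : Set.Iic (t : ℝ) ∩ I = Set.Icc 0 (t : ℝ) := by
    ext s
    exact ⟨fun h => ⟨h.2.1, h.1⟩, fun h => ⟨h.2, h.1, h.2.trans t.2.2⟩⟩
  rw [h2, Measure.restrict_restrict measurableSet_Iic, h3] at h1
  rw [h1, ← ofReal_integral_eq_lintegral_ofReal, integral_Icc_eq_integral_Ioc,
    ← intervalIntegral.integral_of_le t.2.1, intervalIntegral.integral_const_mul, integral_pow,
    ← ENNReal.ofReal_pow t.2.1]
  · congr 1
    have : (n : ℝ) + 1 ≠ 0 := by positivity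
    field_simp
    simp
  · exact (Continuous.continuousOn (by fun_prop)).integrableOn_compact isCompact_Icc
  · filter_upwards [ae_restrict_mem measurableSet_Icc] with s hs
    have := hs.1
    positivity

/-- The maximum of `n + 1` uniform points is at most `t` with probability `t ^ (n + 1)`; the density
is its derivative. -/
theorem map_maxCoord (n : ℕ) :
    Measure.map (maxCoord (n := n)) volume =
      (volume : Measure I).withDensity fun s => ENNReal.ofReal ((n + 1) * (s : ℝ) ^ n) := by
  have := Measure.isProbabilityMeasure_map (μ := (volume : Measure (Fin (n + 1) → I)))
    (measurable_maxCoord (n := n)).aemeasurable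
  refine Measure.ext_of_Iic _ _ fun t => ?_
  rw [Measure.map_apply measurable_maxCoord measurableSet_Iic,
    withDensity_apply _ measurableSet_Iic, setLIntegral_Iic_pow]
  have : maxCoord (n := n) ⁻¹' Set.Iic t = Set.univ.pi fun _ => Set.Iic t := by
    ext x
    simp only [Set.mem_preimage, (isLowerSet_Iic t).maxCoord_mem_iff, Set.mem_univ_pi]
  rw [this, volume_pi, Measure.pi_pi]
  simp

theorem integral_comp_maxCoord (n : ℕ) {φ : I → ℝ} (hφ : Measurable φ) :
    ∫ x, φ (maxCoord (n := n) x) = ∫ s : I, (n + 1) * (s : ℝ) ^ n * φ s := by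
  rw [← integral_map (μ := volume) measurable_maxCoord.aemeasurable hφ.aestronglyMeasurable,
    map_maxCoord, integral_withDensity_eq_integral_toReal_smul (by fun_prop)
      (Filter.Eventually.of_forall fun _ => ENNReal.ofReal_lt_top)]
  refine integral_congr_ae (Filter.Eventually.of_forall fun s => ?_)
  have h0 : (0 : ℝ) ≤ (n + 1) * (s : ℝ) ^ n := by
    have := s.2.1
    positivity
  simp only [ENNReal.toReal_ofReal h0, smul_eq_mul]

open Classical in
theorem prod_ite_mem_isLowerSet {T : Set I} (hT : IsLowerSet T) {n : ℕ} (x : Fin (n + 1) → I) :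
    ∏ i, (if x i ∈ T then (1 : ℝ) else 0) = if maxCoord x ∈ T then 1 else 0 := by
  rw [Finset.prod_boole]
  simp [hT.maxCoord_mem_iff]

namespace Graphon

/-- All pairs lie in a lower set exactly when the pair of maxima does, and the two maxima are
independent with densities `(a + 1) s ^ a` and `(b + 1) s ^ b`. -/
theorem density_completeBipartiteGraph_ofSet {S : Set (I × I)} (hS : MeasurableSet S)
    (hsymm : ∀ x y, (x, y) ∈ S → (y, x) ∈ S) (hl : IsLowerSet S) (a b : ℕ) :
    density (completeBipartiteGraph (Fin (a + 1)) (Fin (b + 1))) (ofSet S hS hsymm) =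
      (a + 1) * (b + 1) * ∫ z in S, (z.1 : ℝ) ^ a * (z.2 : ℝ) ^ b := by
  classical
  have hm : Measurable fun z : I × I => if z ∈ S then (1 : ℝ) else 0 :=
    Measurable.ite hS measurable_const measurable_const
  have hl1 : ∀ y, IsLowerSet {x | (x, y) ∈ S} := fun y s t hts h =>
    hl (show (t, y) ≤ (s, y) from ⟨hts, le_rfl⟩) h
  have hl2 : ∀ x, IsLowerSet {y | (x, y) ∈ S} := fun x s t hts h =>
    hl (show (x, t) ≤ (x, s) from ⟨le_rfl, hts⟩) h
  have hsec : ∀ s : I, (∏ _b : Fin (b + 1), ∫ y : I, if (s, y) ∈ S then (1 : ℝ) else 0) =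
      ∫ y : I, (b + 1) * (y : ℝ) ^ b * if (s, y) ∈ S then 1 else 0 := fun s => by
    rw [← integral_fintype_prod_volume_eq_prod (ι := Fin (b + 1)) (E := fun _ => I)
      fun (_ : Fin (b + 1)) (y : I) => if (s, y) ∈ S then (1 : ℝ) else 0]
    rw [← integral_comp_maxCoord b (φ := fun y => if (s, y) ∈ S then 1 else 0)
      (hm.comp measurable_prodMk_left)]
    exact integral_congr_ae (Filter.Eventually.of_forall fun y =>
      prod_ite_mem_isLowerSet (hl2 s) y)
  rw [completeBipartiteGraph_eq, density_bipartiteGraph _ _ (by simpa only [ofSet_apply] using hm)]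
  have h1 : ∀ x : Fin (a + 1) → I, (∏ _b : Fin (b + 1), ∫ y : I, ∏ i,
      ofSet S hS hsymm (x i) y) =
      ∫ y : I, (b + 1) * (y : ℝ) ^ b * if (maxCoord x, y) ∈ S then 1 else 0 := fun x => by
    rw [← hsec]
    refine Finset.prod_congr rfl fun _ _ => integral_congr_ae
      (Filter.Eventually.of_forall fun y => ?_)
    simp only [ofSet_apply]
    exact prod_ite_mem_isLowerSet (hl1 y) x
  simp only [if_true, h1]
  have hm2 : Measurable fun z : I × I => (b + 1) * (z.2 : ℝ) ^ b * if z ∈ S then (1 : ℝ) else 0 :=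
    Measurable.mul (by fun_prop) hm
  rw [integral_comp_maxCoord a (φ := fun s : I => ∫ y : I, (b + 1) * (y : ℝ) ^ b *
    if (s, y) ∈ S then 1 else 0) hm2.stronglyMeasurable.integral_prod_right.measurable]
  simp only [← integral_const_mul]
  have hm3 : Measurable fun z : I × I =>
      (a + 1) * (z.1 : ℝ) ^ a * ((b + 1) * (z.2 : ℝ) ^ b * if z ∈ S then (1 : ℝ) else 0) :=
    Measurable.mul (by fun_prop) hm2
  rw [← integral_indicator hS]
  refine (integral_prod (μ := (volume : Measure I)) (ν := (volume : Measure I)) _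
    (Integrable.of_bound (C := (a + 1) * (b + 1)) hm3.aestronglyMeasurable
    (Filter.Eventually.of_forall fun z => ?_))).symm.trans ?_
  · have hz1 := pow_le_one₀ (n := a) z.1.2.1 z.1.2.2
    have hz2 := pow_le_one₀ (n := b) z.2.2.1 z.2.2.2
    have hz1' := pow_nonneg z.1.2.1 a
    have hz2' := pow_nonneg z.2.2.1 b
    have ha : (0 : ℝ) < a + 1 := by positivity
    have hb : (0 : ℝ) < b + 1 := by positivity
    rw [Real.norm_of_nonneg (by split_ifs <;> positivity)]
    refine mul_le_mul (mul_le_of_le_one_right ha.le hz1) ?_ (by split_ifs <;> positivity) ha.le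
    split_ifs
    · rw [mul_one]
      exact mul_le_of_le_one_right hb.le hz2
    · simpa using hb.le
  · refine integral_congr_ae (Filter.Eventually.of_forall fun z => ?_)
    by_cases hz : z ∈ S
    · simp only [hz, if_true, Set.indicator_of_mem]
      ring
    · simp [hz]

theorem WeaklyIsomorphic.density_eq {U W : Graphon} (h : WeaklyIsomorphic U W) {V : Type*}
    [Fintype V] (F : SimpleGraph V) : density F U = density F W := by
  rw [density_of_iso (SimpleGraph.Iso.map (Fintype.equivFin V) F),
    density_of_iso (SimpleGraph.Iso.map (Fintype.equivFin V) F)]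
  exact h _ _

/-! ### Recovering the set `{p ≥ 0}` from moments -/

theorem setIntegral_eval_eq_of_moments {S T : Set (I × I)} (p : MvPolynomial (Fin 2) ℝ)
    (h : ∀ a b : ℕ, a ≤ p.totalDegree → b ≤ p.totalDegree →
      ∫ z in S, (z.1 : ℝ) ^ a * (z.2 : ℝ) ^ b = ∫ z in T, (z.1 : ℝ) ^ a * (z.2 : ℝ) ^ b) :
    ∫ z in S, MvPolynomial.eval ![(z.1 : ℝ), (z.2 : ℝ)] p =
      ∫ z in T, MvPolynomial.eval ![(z.1 : ℝ), (z.2 : ℝ)] p := by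
  have key : ∀ R : Set (I × I), ∫ z in R, MvPolynomial.eval ![(z.1 : ℝ), (z.2 : ℝ)] p =
      ∑ m ∈ p.support, p.coeff m * ∫ z in R, (z.1 : ℝ) ^ m 0 * (z.2 : ℝ) ^ m 1 := fun R => by
    simp only [MvPolynomial.eval_eq', Fin.prod_univ_two, Matrix.cons_val_zero, Matrix.cons_val_one]
    rw [integral_finsetSum]
    · simp only [integral_const_mul]
    · intro m _
      exact (Continuous.continuousOn (s := Set.univ) (by fun_prop)).integrableOn_compact
        isCompact_univ |>.mono_set (Set.subset_univ _)
  rw [key, key]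
  refine Finset.sum_congr rfl fun m hm => ?_
  have hle : ∀ i, m i ≤ p.totalDegree := fun i =>
    (MvPolynomial.monomial_le_degreeOf i hm).trans (MvPolynomial.degreeOf_le_totalDegree p i)
  rw [h _ _ (hle 0) (hle 1)]

/-- The set `{g ≥ 0}` maximises the integral of `g`. In case of equality `S` misses `{g < 0}` up to
a null set, and equal measure excludes a smaller `S`; this also settles the zero set of `g`. -/
theorem ae_eq_of_setIntegral_eq {X : Type*} [MeasurableSpace X] {μ : Measure X}
    [IsFiniteMeasure μ] {g : X → ℝ} (hg : Integrable g μ) {S T : Set X} (hS : MeasurableSet S)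
    (hT : MeasurableSet T) (hTg : ∀ x, x ∈ T ↔ 0 ≤ g x) (hST : μ S = μ T)
    (hint : ∫ x in S, g x ∂μ = ∫ x in T, g x ∂μ) : S =ᵐ[μ] T := by
  rw [← integral_indicator hS, ← integral_indicator hT] at hint
  have hnn : ∀ x, 0 ≤ T.indicator g x - S.indicator g x := fun x => by
    by_cases h1 : x ∈ S <;> by_cases h2 : x ∈ T
    · simp [h1, h2]
    · have := not_le.1 (mt (hTg x).2 h2)
      simp [h1, h2, this.le]
    · simpa [h1, h2] using (hTg x).1 h2
    · simp [h1, h2]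
  have h0 : ∫ x, (T.indicator g x - S.indicator g x) ∂μ = 0 := by
    rw [integral_sub (hg.indicator hT) (hg.indicator hS), hint, sub_self]
  rw [integral_eq_zero_iff_of_nonneg hnn ((hg.indicator hT).sub (hg.indicator hS))] at h0
  refine ae_eq_of_ae_subset_of_measure_ge ?_ hST.ge hS.nullMeasurableSet (measure_ne_top _ _)
  filter_upwards [h0] with x hx h1
  by_contra h2
  have h3 : x ∉ T := h2
  have h4 : x ∈ S := h1
  have := not_le.1 (mt (hTg x).2 h3)
  simp [h3, h4] at hx
  linarith

theorem weaklyIsomorphic_ofPolynomial_of_nested (p : MvPolynomial (Fin 2) ℝ) (hp : p.IsSymmetric)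
    (hanti : Antitone (fun z : I × I => MvPolynomial.eval ![(z.1 : ℝ), (z.2 : ℝ)] p))
    {E : Set (I × I)} (hE : MeasurableSet E) (hsymm : ∀ x y, (x, y) ∈ E → (y, x) ∈ E)
    (hnest : ∀ᵐ z : I × I, volume (Prod.mk z.1 ⁻¹' E \ Prod.mk z.2 ⁻¹' E) = 0 ∨
      volume (Prod.mk z.2 ⁻¹' E \ Prod.mk z.1 ⁻¹' E) = 0)
    (hdens : ∀ a b : ℕ, a ≤ p.totalDegree + 1 → b ≤ p.totalDegree + 1 →
      density (completeBipartiteGraph (Fin a) (Fin b)) (ofSet E hE hsymm) =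
        density (completeBipartiteGraph (Fin a) (Fin b)) (ofPolynomial p hp)) :
    WeaklyIsomorphic (ofSet E hE hsymm) (ofPolynomial p hp) := by
  classical
  obtain ⟨S, hS, hSs, hSl, hES⟩ := exists_isLowerSet_of_nested hE hsymm hnest
  have hcont : Continuous fun z : I × I => MvPolynomial.eval ![(z.1 : ℝ), (z.2 : ℝ)] p := by
    refine (MvPolynomial.continuous_eval p).comp (continuous_pi fun i => ?_)
    fin_cases i
    · exact continuous_subtype_val.comp continuous_fst
    · exact continuous_subtype_val.comp continuous_snd
  let T : Set (I × I) := {z | 0 ≤ MvPolynomial.eval ![(z.1 : ℝ), (z.2 : ℝ)] p}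
  have hT : MeasurableSet T := measurableSet_le measurable_const hcont.measurable
  have hTl : IsLowerSet T := fun z w hwz hz => le_trans (α := ℝ) hz (hanti hwz)
  have hiff : ∀ x y : I, (ofPolynomial p hp) x y = if (x, y) ∈ T then 1 else 0 := fun x y =>
    if_congr Iff.rfl rfl rfl
  have hTs : ∀ x y, (x, y) ∈ T → (y, x) ∈ T := fun x y h => by
    have h1 := (ofPolynomial p hp).symm' x y
    rw [hiff, hiff, if_pos h] at h1
    by_contra h2
    rw [if_neg h2] at h1
    exact one_ne_zero h1
  have hTP : WeaklyIsomorphic (ofSet T hT hTs) (ofPolynomial p hp) :=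
    weaklyIsomorphic_of_ae (Filter.Eventually.of_forall fun z => by rw [hiff, ofSet_apply])
  have hmom : ∀ a b : ℕ, a ≤ p.totalDegree → b ≤ p.totalDegree →
      ∫ z in S, (z.1 : ℝ) ^ a * (z.2 : ℝ) ^ b = ∫ z in T, (z.1 : ℝ) ^ a * (z.2 : ℝ) ^ b := by
    intro a b ha hb
    -- The graph `K_{a+1,b+1}` gives the moment of exponents `a, b`, whence the bound `deg p + 1`.
    have h1 := hdens (a + 1) (b + 1) (by omega) (by omega)
    rw [hES.density_eq, ← hTP.density_eq, density_completeBipartiteGraph_ofSet hS hSs hSl,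
      density_completeBipartiteGraph_ofSet hT hTs hTl] at h1
    exact mul_left_cancel₀ (by positivity) h1
  have hvol : volume S = volume T := by
    have h1 := hmom 0 0 (Nat.zero_le _) (Nat.zero_le _)
    simp only [pow_zero, mul_one, setIntegral_const, smul_eq_mul] at h1
    exact (measureReal_eq_measureReal_iff).1 h1
  have hae : S =ᵐ[volume] T := ae_eq_of_setIntegral_eq
    (hcont.continuousOn.integrableOn_compact isCompact_univ |>.integrable_of_forall_notMem_eq_zero
      (by simp))
    hS hT (fun _ => Iff.rfl) hvol (setIntegral_eval_eq_of_moments p hmom)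
  refine (hES.trans (weaklyIsomorphic_of_ae ?_)).trans hTP
  filter_upwards [hae] with z hz
  rw [ofSet_apply, ofSet_apply]
  exact if_congr hz.to_iff rfl rfl

end Graphon

/-! ### Nestedness and the coloured 4-cycle -/

theorem ae_or_ae_of_ae_prod_or {X Y : Type*} [MeasurableSpace X] [MeasurableSpace Y]
    {μ : Measure X} {ν : Measure Y} [SFinite ν] {p : X → Prop} {q : Y → Prop}
    (h : ∀ᵐ z ∂μ.prod ν, p z.1 ∨ q z.2) : (∀ᵐ x ∂μ, p x) ∨ ∀ᵐ y ∂ν, q y := by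
  by_cases hp : ∀ᵐ x ∂μ, p x
  · exact Or.inl hp
  · right
    obtain ⟨x, hx, hxy⟩ :=
      ((Filter.not_eventually.1 hp).and_eventually (Measure.ae_ae_of_ae_prod h)).exists
    filter_upwards [hxy] with y hy
    exact hy.resolve_left hx

namespace Graphon

/-- Almost all pairs of neighbourhoods are nested, up to null sets. -/
def IsNested (U : Graphon) : Prop :=
  ∀ᵐ z : I × I, (∀ᵐ y : I, U z.1 y * (1 - U z.2 y) = 0) ∨ ∀ᵐ y : I, U z.2 y * (1 - U z.1 y) = 0

/-- If `U x y * (1 - U x' y) = 0`, then one of the two values is 0 or 1. For fixed `y` the points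
`x, x'` are independent, so almost every `x` has this property. -/
theorem IsNested.ae_eq_zero_or_one {U : Graphon} (hU : Measurable fun z : I × I => U z.1 z.2)
    (h : U.IsNested) : ∀ᵐ z : I × I, U z.1 z.2 = 0 ∨ U z.1 z.2 = 1 := by
  have hm : MeasurableSet {z : I × I | U z.1 z.2 = 0 ∨ U z.1 z.2 = 1} :=
    (hU (measurableSet_singleton 0)).union (hU (measurableSet_singleton 1))
  have h1 : ∀ᵐ z : I × I, ∀ᵐ y : I, (U z.1 y = 0 ∨ U z.1 y = 1) ∨ (U z.2 y = 0 ∨ U z.2 y = 1) := by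
    filter_upwards [h] with z hz
    rcases hz with hz | hz <;> filter_upwards [hz] with y hy <;>
      rcases mul_eq_zero.1 hy with hy | hy
    · exact Or.inl (Or.inl hy)
    · exact Or.inr (Or.inr (sub_eq_zero.1 hy).symm)
    · exact Or.inr (Or.inl hy)
    · exact Or.inl (Or.inr (sub_eq_zero.1 hy).symm)
  have hm1 : MeasurableSet {w : (I × I) × I |
      (U w.1.1 w.2 = 0 ∨ U w.1.1 w.2 = 1) ∨ (U w.1.2 w.2 = 0 ∨ U w.1.2 w.2 = 1)} :=
    ((show Measurable fun w : (I × I) × I => (w.1.1, w.2) by fun_prop) hm).union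
      ((show Measurable fun w : (I × I) × I => (w.1.2, w.2) by fun_prop) hm)
  have h2 := (Measure.ae_ae_comm (μ := (volume : Measure (I × I))) (ν := (volume : Measure I))
    (p := fun z y => (U z.1 y = 0 ∨ U z.1 y = 1) ∨ (U z.2 y = 0 ∨ U z.2 y = 1)) hm1).1 h1
  refine (Measure.ae_prod_iff_ae_ae hm).2 ?_
  filter_upwards [h2] with y hy
  have h3 := ae_or_ae_of_ae_prod_or (p := fun x => U x y = 0 ∨ U x y = 1)
    (q := fun x => U x y = 0 ∨ U x y = 1) hy
  filter_upwards [or_self_iff.1 h3] with x hx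
  rwa [U.symm' y x]

theorem IsNested.weaklyIsomorphic_ofPolynomial {U : Graphon}
    (hU : Measurable fun z : I × I => U z.1 z.2) (h : U.IsNested) (p : MvPolynomial (Fin 2) ℝ)
    (hp : p.IsSymmetric)
    (hanti : Antitone (fun z : I × I => MvPolynomial.eval ![(z.1 : ℝ), (z.2 : ℝ)] p))
    (hdens : ∀ a b : ℕ, a ≤ p.totalDegree + 1 → b ≤ p.totalDegree + 1 →
      density (completeBipartiteGraph (Fin a) (Fin b)) U =
        density (completeBipartiteGraph (Fin a) (Fin b)) (ofPolynomial p hp)) :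
    WeaklyIsomorphic U (ofPolynomial p hp) := by
  classical
  let E : Set (I × I) := {z | U z.1 z.2 = 1}
  have hE : MeasurableSet E := hU (measurableSet_singleton 1)
  have hsymm : ∀ x y, (x, y) ∈ E → (y, x) ∈ E := fun x y hxy => (U.symm' y x).trans hxy
  have hUE : WeaklyIsomorphic U (ofSet E hE hsymm) := weaklyIsomorphic_of_ae <| by
    filter_upwards [h.ae_eq_zero_or_one hU] with z hz
    rw [ofSet_apply]
    rcases hz with hz | hz
    · rw [if_neg (show (z.1, z.2) ∉ E from fun h1 => zero_ne_one (hz.symm.trans h1)), hz]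
    · rw [if_pos (show (z.1, z.2) ∈ E from hz), hz]
  have hsub : ∀ x x' : I, (∀ᵐ y : I, U x y * (1 - U x' y) = 0) →
      volume (Prod.mk x ⁻¹' E \ Prod.mk x' ⁻¹' E) = 0 := fun x x' hx => by
    refine measure_mono_null (fun y hy => ?_) (ae_iff.1 hx)
    have h1 : U x y = 1 := hy.1
    have h2 : ¬ U x' y = 1 := hy.2
    exact mul_ne_zero (by simp [h1]) (sub_ne_zero.2 (Ne.symm h2))
  refine hUE.trans (weaklyIsomorphic_ofPolynomial_of_nested p hp hanti hE hsymm ?_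
    fun a b ha hb => (hUE.density_eq _).symm.trans (hdens a b ha hb))
  filter_upwards [h] with z hz
  exact hz.imp (hsub _ _) (hsub _ _)

theorem labeledDensity_coloredC4 (U : Graphon) (x : Fin 4 → I) :
    labeledDensity coloredC4 U x =
      U (x 0) (x 1) * U (x 2) (x 3) * ((1 - U (x 1) (x 2)) * (1 - U (x 3) (x 0))) := by
  classical
  unfold labeledDensity
  have hb : coloredC4.blue.edgeFinset = {s(0, 1), s(2, 3)} := by
    ext e
    rw [SimpleGraph.mem_edgeFinset]
    simp only [coloredC4, SimpleGraph.edgeSet_fromEdgeSet]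
    simp
    rintro (rfl | rfl) <;> decide
  have hr : coloredC4.red.edgeFinset = {s(1, 2), s(3, 0)} := by
    ext e
    rw [SimpleGraph.mem_edgeFinset]
    simp only [coloredC4, SimpleGraph.edgeSet_fromEdgeSet]
    simp
    rintro (rfl | rfl) <;> decide
  rw [hb, hr, Finset.prod_pair (by decide), Finset.prod_pair (by decide)]
  rfl

theorem measurePreserving_vec4 :
    MeasurePreserving (fun w : (I × I) × (I × I) => ![w.1.1, w.2.1, w.1.2, w.2.2])
      volume volume := by
  have hm : Measurable (fun w : (I × I) × (I × I) => ![w.1.1, w.2.1, w.1.2, w.2.2]) := by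
    refine measurable_pi_lambda _ fun i => ?_
    fin_cases i
    · exact (measurable_fst.comp measurable_fst)
    · exact (measurable_fst.comp measurable_snd)
    · exact (measurable_snd.comp measurable_fst)
    · exact (measurable_snd.comp measurable_snd)
  refine ⟨hm, (Measure.pi_eq fun s hs => ?_).symm⟩
  rw [Measure.map_apply hm (MeasurableSet.univ_pi hs)]
  have : (fun w : (I × I) × (I × I) => ![w.1.1, w.2.1, w.1.2, w.2.2]) ⁻¹' Set.univ.pi s =
      (s 0 ×ˢ s 2) ×ˢ (s 1 ×ˢ s 3) := by
    ext w
    simp only [Set.mem_preimage, Set.mem_univ_pi, Fin.forall_fin_succ, Set.mem_prod]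
    simp
    tauto
  rw [this]
  refine (Measure.prod_prod (μ := (volume : Measure (I × I))) (ν := volume) _ _).trans ?_
  rw [Fin.prod_univ_four]
  have hp : ∀ s t : Set I, (volume : Measure (I × I)) (s ×ˢ t) = volume s * volume t :=
    fun s t => Measure.prod_prod (μ := (volume : Measure I)) (ν := volume) s t
  rw [hp, hp]
  ring

/-- With nodes 0 and 2 fixed, the integrand is a function of node 1 times a function of node 3, so
one factor vanishes a.e. -/
theorem isNested_of_labeledDensity_eq_zero {U : Graphon}
    (h : ∀ᵐ x : Fin 4 → I, labeledDensity coloredC4 U x = 0) : U.IsNested := by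
  have h1 := measurePreserving_vec4.quasiMeasurePreserving.ae h
  filter_upwards [Measure.ae_ae_of_ae_prod h1] with z hz
  refine ae_or_ae_of_ae_prod_or (p := fun y => U z.1 y * (1 - U z.2 y) = 0)
    (q := fun y => U z.2 y * (1 - U z.1 y) = 0) ?_
  filter_upwards [hz] with y hy
  rw [labeledDensity_coloredC4] at hy
  have hy' : U z.1 y.1 * U z.2 y.2 * ((1 - U y.1 z.2) * (1 - U y.2 z.1)) = 0 := hy
  rw [U.symm' y.1 z.2, U.symm' y.2 z.1] at hy'
  rw [← mul_eq_zero]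
  linear_combination hy'

theorem labeledDensity_congr_ae {U W : Graphon} (h : ∀ᵐ z : I × I, U z.1 z.2 = W z.1 z.2)
    {V : Type*} [Fintype V] (F : TwoEdgeColoredGraph V) :
    ∀ᵐ x : V → I, labeledDensity F U x = labeledDensity F W x := by
  classical
  have key : ∀ G : SimpleGraph V, ∀ᵐ x : V → I, ∀ e ∈ G.edgeFinset,
      U.edgeVal x e = W.edgeVal x e := fun G => by
    refine (Finset.eventually_all _).2 fun e he => ?_
    induction e with
    | _ i j =>
      have hij : i ≠ j := by
        rw [SimpleGraph.mem_edgeFinset, SimpleGraph.mem_edgeSet] at he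
        exact he.ne
      exact (measurePreserving_pair hij).quasiMeasurePreserving.ae h
  filter_upwards [key F.blue, key F.red] with x hb hr
  unfold labeledDensity
  rw [Finset.prod_congr rfl hb]
  congr 1
  exact Finset.prod_congr rfl fun e he => by rw [hr e he]

theorem ofPolynomial_eq_zero_or_one (p : MvPolynomial (Fin 2) ℝ) (hp : p.IsSymmetric) (s t : I) :
    ofPolynomial p hp s t = 0 ∨ ofPolynomial p hp s t = 1 := by
  unfold ofPolynomial
  dsimp only
  split_ifs
  · exact Or.inr rfl
  · exact Or.inl rfl

theorem ofPolynomial_eq_one_of_le {p : MvPolynomial (Fin 2) ℝ} {hp : p.IsSymmetric}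
    (hanti : Antitone (fun z : I × I => MvPolynomial.eval ![(z.1 : ℝ), (z.2 : ℝ)] p))
    {s s' t : I} (hs : s ≤ s') (h : ofPolynomial p hp s' t = 1) : ofPolynomial p hp s t = 1 := by
  have hle := hanti (show (s, t) ≤ (s', t) from ⟨hs, le_rfl⟩)
  unfold ofPolynomial at h ⊢
  dsimp only at h hle ⊢
  split_ifs at h with h'
  · rw [if_pos (h'.trans hle)]
  · exact absurd h zero_ne_one

theorem measurable_ofPolynomial (p : MvPolynomial (Fin 2) ℝ) (hp : p.IsSymmetric) :
    Measurable fun z : I × I => ofPolynomial p hp z.1 z.2 := by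
  refine Measurable.ite ?_ measurable_const measurable_const
  refine measurableSet_le measurable_const (Continuous.measurable ?_)
  refine (MvPolynomial.continuous_eval p).comp (continuous_pi fun i => ?_)
  fin_cases i
  · exact continuous_subtype_val.comp continuous_fst
  · exact continuous_subtype_val.comp continuous_snd

/-- If both blue edges are present, the smaller of the points 0 and 2 is also adjacent to the
neighbour of the larger, which kills a red factor. -/
theorem labeledDensity_coloredC4_ofPolynomial (p : MvPolynomial (Fin 2) ℝ) (hp : p.IsSymmetric)
    (hanti : Antitone (fun z : I × I => MvPolynomial.eval ![(z.1 : ℝ), (z.2 : ℝ)] p))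
    (x : Fin 4 → I) : labeledDensity coloredC4 (ofPolynomial p hp) x = 0 := by
  rw [labeledDensity_coloredC4]
  rcases ofPolynomial_eq_zero_or_one p hp (x 0) (x 1) with h1 | h1
  · rw [h1, zero_mul, zero_mul]
  rcases ofPolynomial_eq_zero_or_one p hp (x 2) (x 3) with h2 | h2
  · rw [h2, mul_zero, zero_mul]
  rcases le_total (x 0) (x 2) with h | h
  · rw [(ofPolynomial p hp).symm' (x 3) (x 0), ofPolynomial_eq_one_of_le hanti h h2, sub_self,
      mul_zero, mul_zero]
  · rw [(ofPolynomial p hp).symm' (x 1) (x 2), ofPolynomial_eq_one_of_le hanti h h1, sub_self,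
      zero_mul, mul_zero]

end Graphon

/-! ### Forcing nestedness by finitely many densities -/

theorem Finset.abs_prod_sub_prod_le_pow_card {ι : Type*} (s : Finset ι) {C : ℝ} (hC : 1 ≤ C)
    {a b : ι → ℝ} (ha : ∀ i, |a i| ≤ C) (hb : ∀ i, |b i| ≤ C) :
    |∏ i ∈ s, a i - ∏ i ∈ s, b i| ≤ C ^ s.card * ∑ i ∈ s, |a i - b i| := by
  classical
  induction s using Finset.induction_on with
  | empty => simp
  | insert j s hj ih =>
    rw [Finset.prod_insert hj, Finset.prod_insert hj, Finset.sum_insert hj,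
      Finset.card_insert_of_notMem hj]
    have h1 : |∏ i ∈ s, b i| ≤ C ^ s.card := by
      rw [Finset.abs_prod, ← Finset.prod_const]
      exact Finset.prod_le_prod (fun _ _ => abs_nonneg _) fun i _ => hb i
    have h0 : 0 ≤ C ^ s.card := by positivity
    calc |a j * ∏ i ∈ s, a i - b j * ∏ i ∈ s, b i|
        = |a j * (∏ i ∈ s, a i - ∏ i ∈ s, b i) + (a j - b j) * ∏ i ∈ s, b i| := by ring_nf
      _ ≤ |a j| * |∏ i ∈ s, a i - ∏ i ∈ s, b i| + |a j - b j| * |∏ i ∈ s, b i| := by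
          rw [← abs_mul, ← abs_mul]
          exact abs_add_le _ _
      _ ≤ C * (C ^ s.card * ∑ i ∈ s, |a i - b i|) + |a j - b j| * (C * C ^ s.card) := by
          gcongr
          · exact ha j
          · exact h1.trans (le_mul_of_one_le_left h0 hC)
      _ = C ^ (s.card + 1) * (|a j - b j| + ∑ i ∈ s, |a i - b i|) := by ring

namespace Graphon

theorem measurable_section {U : Graphon} (hU : Measurable fun z : I × I => U z.1 z.2) (x : I) :
    Measurable fun y => U x y := hU.comp measurable_prodMk_left

theorem integrable_section {U : Graphon} (hU : Measurable fun z : I × I => U z.1 z.2) (x : I) :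
    Integrable fun y => U x y := by
  obtain ⟨C, hC⟩ := U.bounded'
  exact Integrable.of_bound (measurable_section hU x).aestronglyMeasurable C
    (Filter.Eventually.of_forall fun y => hC x y)

theorem integrable_section_pow {U : Graphon} (hU : Measurable fun z : I × I => U z.1 z.2) (x : I)
    (n : ℕ) : Integrable fun y => U x y ^ n := by
  obtain ⟨C, hC⟩ := U.bounded'
  refine Integrable.of_bound ((measurable_section hU x).pow_const n).aestronglyMeasurable (C ^ n)
    (Filter.Eventually.of_forall fun y => ?_)
  rw [norm_pow]
  exact pow_le_pow_left₀ (norm_nonneg _) (hC x y) n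

theorem integrable_section_prod {U : Graphon} (hU : Measurable fun z : I × I => U z.1 z.2)
    {n : ℕ} (x : Fin n → I) : Integrable fun y => ∏ a, U (x a) y := by
  obtain ⟨C, hC⟩ := U.bounded'
  refine Integrable.of_bound
    (Finset.measurable_prod _ fun a _ => measurable_section hU (x a)).aestronglyMeasurable
    (∏ _a : Fin n, C) (Filter.Eventually.of_forall fun y => ?_)
  rw [norm_prod]
  exact Finset.prod_le_prod (fun _ _ => norm_nonneg _) fun a _ => hC _ _

/-- A relation between the star densities and the degrees that holds almost everywhere also holds
on the diagonal. -/
theorem integral_pow_eq_of_ae_exists {U : Graphon} (hU : Measurable fun z : I × I => U z.1 z.2)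
    {n : ℕ} (h : ∀ᵐ x : Fin n → I, ∃ i, ∫ y, ∏ a, U (x a) y = ∫ y, U (x i) y) :
    ∀ᵐ x : I, ∫ y, U x y ^ n = ∫ y, U x y := by
  obtain ⟨C₀, hC₀⟩ := U.bounded'
  obtain ⟨C, hC1, hC⟩ : ∃ C : ℝ, 1 ≤ C ∧ ∀ x y, |U x y| ≤ C :=
    ⟨max C₀ 1, le_max_right _ _, fun x y => (hC₀ x y).trans (le_max_left _ _)⟩
  have : Fact ((1 : ENNReal) ≠ ⊤) := ⟨ENNReal.one_ne_top⟩
  let φ : I → Lp ℝ 1 (volume : Measure I) := fun x => (integrable_section hU x).toL1 _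
  have hφ : ∀ x x', dist (φ x) (φ x') = ∫ y, |U x y - U x' y| := fun x x' => by
    rw [L1.dist_eq_integral_dist]
    refine integral_congr_ae ?_
    filter_upwards [(integrable_section hU x).coeFn_toL1, (integrable_section hU x').coeFn_toL1]
      with y h1 h2
    rw [h1, h2, Real.dist_eq]
  have hcont : ∀ ε > 0, ∀ᵐ x : I,
      |(∫ y, U x y ^ n) - ∫ y, U x y| ≤ (C ^ n * n + 1) * (2 * ε) := by
    intro ε hε
    -- Separability of `L¹` covers all sections by countably many `ε`-balls, so each ball may be
    -- treated separately.
    let g := TopologicalSpace.denseSeq (Lp ℝ 1 (volume : Measure I))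
    have hcover : ∀ x, ∃ k, dist (φ x) (g k) < ε := fun x =>
      (TopologicalSpace.denseRange_denseSeq _).exists_dist_lt (φ x) hε
    have hpiece : ∀ k, ∀ᵐ x : I, dist (φ x) (g k) < ε →
        |(∫ y, U x y ^ n) - ∫ y, U x y| ≤ (C ^ n * n + 1) * (2 * ε) := by
      intro k
      let A : Set I := {x | dist (φ x) (g k) < ε}
      by_cases hA : volume A = 0
      · filter_upwards [measure_eq_zero_iff_ae_notMem.1 hA] with x hx hx'
        exact absurd hx' hx
      · have hpi : volume (Set.univ.pi fun _ : Fin n => A) ≠ 0 := by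
          rw [volume_pi, Measure.pi_pi]
          exact Finset.prod_ne_zero_iff.2 fun _ _ => hA
        -- A non-null ball has a non-null `n`-th power, which contains a tuple satisfying the
        -- relation. All its sections are within `2 * ε` of that of any `z` in the ball.
        obtain ⟨x, hxA, i, hi⟩ := ((frequently_ae_mem_iff.2 hpi).and_eventually h).exists
        refine Filter.Eventually.of_forall fun z hz => ?_
        have hd : ∀ j, ∫ y, |U (x j) y - U z y| ≤ 2 * ε := fun j => by
          rw [← hφ]
          have h1 : dist (φ (x j)) (g k) < ε := hxA j (Set.mem_univ j)
          have h2 := dist_triangle_right (φ (x j)) (φ z) (g k)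
          linarith
        have hab : ∀ j, Integrable fun y => |U (x j) y - U z y| := fun j =>
          ((integrable_section hU (x j)).sub (integrable_section hU z)).abs
        have e1 : |(∫ y, U (x i) y) - ∫ y, U z y| ≤ 2 * ε := by
          rw [← integral_sub (integrable_section hU (x i)) (integrable_section hU z)]
          exact (abs_integral_le_integral_abs).trans (hd i)
        have e2 : |(∫ y, ∏ a, U (x a) y) - ∫ y, U z y ^ n| ≤ C ^ n * n * (2 * ε) := by
          rw [← integral_sub (integrable_section_prod hU x) (integrable_section_pow hU z n)]
          calc |∫ y, ((∏ a, U (x a) y) - U z y ^ n)|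
              ≤ ∫ y, |(∏ a, U (x a) y) - U z y ^ n| := abs_integral_le_integral_abs
            _ ≤ ∫ y, C ^ n * ∑ a, |U (x a) y - U z y| := by
                refine integral_mono_of_nonneg
                  (Filter.Eventually.of_forall fun y => abs_nonneg _)
                  ((integrable_finsetSum _ fun a _ => hab a).const_mul _)
                  (Filter.Eventually.of_forall fun y => ?_)
                have := Finset.abs_prod_sub_prod_le_pow_card (Finset.univ : Finset (Fin n)) hC1
                  (a := fun a => U (x a) y) (b := fun _ => U z y) (fun a => hC _ _)
                  (fun _ => hC _ _)
                simpa using this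
            _ = C ^ n * ∑ a, ∫ y, |U (x a) y - U z y| := by
                rw [integral_const_mul, integral_finsetSum _ fun a _ => hab a]
            _ ≤ C ^ n * ∑ _a : Fin n, 2 * ε := by
                gcongr with a
                exact hd a
            _ = C ^ n * n * (2 * ε) := by
                simp
                ring
        rw [hi] at e2
        have := abs_sub_le (∫ y, U z y ^ n) (∫ y, U (x i) y) (∫ y, U z y)
        rw [abs_sub_comm] at e2
        linarith
    filter_upwards [ae_all_iff.2 hpiece] with x hx
    obtain ⟨k, hk⟩ := hcover x
    exact hx k hk
  have hseq : ∀ k : ℕ, ∀ᵐ x : I,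
      |(∫ y, U x y ^ n) - ∫ y, U x y| ≤ (C ^ n * n + 1) * (2 * (1 / ((k : ℝ) + 1))) :=
    fun k => hcont _ (by positivity)
  filter_upwards [ae_all_iff.2 hseq] with x hx
  have hlim : Filter.Tendsto (fun k : ℕ => (C ^ n * n + 1) * (2 * (1 / ((k : ℝ) + 1))))
      Filter.atTop (nhds ((C ^ n * n + 1) * (2 * 0))) :=
    (tendsto_one_div_add_atTop_nhds_zero_nat.const_mul 2).const_mul _
  have h0 := ge_of_tendsto' hlim hx
  rw [mul_zero, mul_zero] at h0
  exact sub_eq_zero.1 (abs_nonpos_iff.1 h0)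

/-- On the diagonal the moments of order 2, 3, 4 of a section equal its degree, so the integral of
`(u (1 - u))² = u² - 2u³ + u⁴` is zero. For 0-1 valued sections the relation for `n = 2` is
inclusion of one neighbourhood in the other. -/
theorem isNested_of_star_relations {U : Graphon} (hU : Measurable fun z : I × I => U z.1 z.2)
    (h : ∀ n, 2 ≤ n → n ≤ 4 →
      ∀ᵐ x : Fin n → I, ∃ i, ∫ y, ∏ a, U (x a) y = ∫ y, U (x i) y) : U.IsNested := by
  have hm : MeasurableSet {z : I × I | U z.1 z.2 = 0 ∨ U z.1 z.2 = 1} :=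
    (hU (measurableSet_singleton 0)).union (hU (measurableSet_singleton 1))
  have h01 : ∀ᵐ z : I × I, U z.1 z.2 = 0 ∨ U z.1 z.2 = 1 := by
    refine (Measure.ae_prod_iff_ae_ae hm).2 ?_
    filter_upwards [integral_pow_eq_of_ae_exists hU (h 2 le_rfl (by norm_num)),
      integral_pow_eq_of_ae_exists hU (h 3 (by norm_num) (by norm_num)),
      integral_pow_eq_of_ae_exists hU (h 4 (by norm_num) le_rfl)] with x h2 h3 h4
    have i2 := integrable_section_pow hU x 2
    have i3 := integrable_section_pow hU x 3
    have i4 := integrable_section_pow hU x 4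
    have hexp : (fun y => (U x y * (1 - U x y)) ^ 2) =
        fun y => (U x y ^ 2 + U x y ^ 4) - 2 * U x y ^ 3 := by
      funext y
      ring
    have i24 : Integrable fun y => U x y ^ 2 + U x y ^ 4 := i2.add i4
    have hint : Integrable fun y => (U x y * (1 - U x y)) ^ 2 := by
      rw [hexp]
      exact i24.sub (i3.const_mul 2)
    have hz : ∫ y, (U x y * (1 - U x y)) ^ 2 = 0 := by
      rw [hexp, integral_sub i24 (i3.const_mul 2), integral_add i2 i4, integral_const_mul,
        h2, h3, h4]
      ring
    rw [integral_eq_zero_iff_of_nonneg (fun y => sq_nonneg _) hint] at hz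
    filter_upwards [hz] with y hy
    have := pow_eq_zero_iff (two_ne_zero) |>.1 hy
    rcases mul_eq_zero.1 this with h | h
    · exact Or.inl h
    · exact Or.inr (sub_eq_zero.1 h).symm
  have h2 : ∀ᵐ z : I × I, ∃ i, ∫ y, ∏ a, U (![z.1, z.2] a) y = ∫ y, U (![z.1, z.2] i) y :=
    (volume_preserving_finTwoArrow I).symm.quasiMeasurePreserving.ae (h 2 le_rfl (by norm_num))
  have h01' : ∀ᵐ x : I, ∀ᵐ y : I, U x y = 0 ∨ U x y = 1 := Measure.ae_ae_of_ae_prod h01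
  have hl : ∀ᵐ z : I × I, ∀ᵐ y : I, U z.1 y = 0 ∨ U z.1 y = 1 :=
    Measure.quasiMeasurePreserving_fst.ae h01'
  have hr : ∀ᵐ z : I × I, ∀ᵐ y : I, U z.2 y = 0 ∨ U z.2 y = 1 :=
    Measure.quasiMeasurePreserving_snd.ae h01'
  have key : ∀ x x' : I, (∀ᵐ y : I, U x y = 0 ∨ U x y = 1) → (∀ᵐ y : I, U x' y = 0 ∨ U x' y = 1) →
      ∫ y, U x y * U x' y = ∫ y, U x y → ∀ᵐ y : I, U x y * (1 - U x' y) = 0 := by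
    intro x x' hx hx' heq
    have ip : Integrable fun y => U x y * U x' y := by
      simpa [Fin.prod_univ_two] using integrable_section_prod hU ![x, x']
    have hz : ∫ y, U x y * (1 - U x' y) = 0 := by
      simp only [mul_sub, mul_one]
      rw [integral_sub (integrable_section hU x) ip, heq, sub_self]
    refine (integral_eq_zero_iff_of_nonneg_ae ?_ ?_).1 hz
    · filter_upwards [hx, hx'] with y h h'
      rcases h with h | h <;> rcases h' with h' | h' <;> simp [h, h']
    · simp only [mul_sub, mul_one]
      exact (integrable_section hU x).sub ip
  filter_upwards [h2, hl, hr] with z hz hzl hzr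
  obtain ⟨i, hi⟩ := hz
  simp only [Fin.prod_univ_two, Matrix.cons_val_zero, Matrix.cons_val_one] at hi
  fin_cases i
  · exact Or.inl (key _ _ hzl hzr hi)
  · refine Or.inr (key _ _ hzr hzl ?_)
    simp only [mul_comm (U z.2 _)]
    exact hi

open Classical in
theorem integrable_prod_integral_prod {A B : Type*} [Fintype A] [Fintype B] (R : A → B → Prop)
    {U : Graphon} (hU : Measurable fun z : I × I => U z.1 z.2) :
    Integrable fun x : A → I => ∏ b, ∫ y : I, ∏ a, if R a b then U (x a) y else 1 := by
  obtain ⟨C, hC⟩ := U.bounded'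
  have hm : ∀ b, Measurable fun z : (A → I) × I => ∏ a, if R a b then U (z.1 a) z.2 else 1 := by
    intro b
    refine Finset.measurable_prod _ fun a _ => ?_
    split_ifs
    · exact hU.comp (show Measurable fun z : (A → I) × I => (z.1 a, z.2) by fun_prop)
    · exact measurable_const
  refine Integrable.of_bound (Finset.measurable_prod _ fun b _ =>
    (hm b).stronglyMeasurable.integral_prod_right.measurable).aestronglyMeasurable
    (∏ _b : B, ∏ _a : A, max C 1) (Filter.Eventually.of_forall fun x => ?_)
  rw [norm_prod]
  refine Finset.prod_le_prod (fun b _ => norm_nonneg _) fun b _ => ?_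
  refine (norm_integral_le_of_norm_le_const (C := ∏ _a : A, max C 1)
    (Filter.Eventually.of_forall fun y => ?_)).trans_eq (by simp)
  rw [norm_prod]
  refine Finset.prod_le_prod (fun a _ => norm_nonneg _) fun a _ => ?_
  split_ifs
  · exact (hC _ _).trans (le_max_left _ _)
  · simp

/-- The product of the squared differences of a star density and the degrees of its leaves. -/
noncomputable def starDefect (n : ℕ) (U : Graphon) (x : Fin n → I) : ℝ :=
  ∏ j : Fin n × Fin 2, ((∫ y, ∏ a, U (x a) y) - ∫ y, U (x j.1) y)

theorem starDefect_nonneg (n : ℕ) (U : Graphon) (x : Fin n → I) : 0 ≤ starDefect n U x := by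
  rw [starDefect, Fintype.prod_prod_type]
  refine Finset.prod_nonneg fun i _ => ?_
  rw [Fin.prod_univ_two]
  exact mul_self_nonneg _

/-- The leaf `a` is adjacent to the copy `j` of the centre: copies in `T` are joined to all leaves,
the other ones only to their own leaf. -/
def starRelation {n : ℕ} (T : Finset (Fin n × Fin 2)) (a : Fin n) (j : Fin n × Fin 2) : Prop :=
  j ∈ T ∨ a = j.1

-- Expanding the product over the set `T` of centres joined to all leaves makes each term a
-- bipartite integrand. The squares use two distinct copies of each centre, so no multiple edges
-- arise.
open Classical in
theorem starDefect_eq_sum (n : ℕ) (U : Graphon) (x : Fin n → I) :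
    starDefect n U x = ∑ T ∈ (Finset.univ : Finset (Fin n × Fin 2)).powerset,
      (-1) ^ (Finset.univ \ T).card *
        ∏ j, ∫ y : I, ∏ a, if starRelation T a j then U (x a) y else 1 := by
  unfold starDefect
  simp only [sub_eq_add_neg]
  rw [Finset.prod_add]
  refine Finset.sum_congr rfl fun T _ => ?_
  rw [Finset.prod_neg, ← Finset.prod_sdiff (Finset.subset_univ T)]
  have h1 : ∏ j ∈ T, (∫ y : I, ∏ a, if starRelation T a j then U (x a) y else 1) =
      ∏ j ∈ T, ∫ y, ∏ a, U (x a) y :=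
    Finset.prod_congr rfl fun j hj => by
      simp only [starRelation, hj, true_or, if_true]
  have h2 : ∏ j ∈ Finset.univ \ T, (∫ y : I, ∏ a, if starRelation T a j then U (x a) y else 1) =
      ∏ j ∈ Finset.univ \ T, ∫ y, U (x j.1) y :=
    Finset.prod_congr rfl fun j hj => by
      have hj' : j ∉ T := (Finset.mem_sdiff.1 hj).2
      simp only [starRelation, hj', false_or, Finset.prod_ite_eq', Finset.mem_univ, if_true]
  rw [h1, h2]
  ring

theorem integrable_starDefect (n : ℕ) {U : Graphon} (hU : Measurable fun z : I × I => U z.1 z.2) :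
    Integrable (starDefect n U) := by
  classical
  rw [show starDefect n U = _ from funext (starDefect_eq_sum n U)]
  exact integrable_finsetSum _ fun T _ =>
    (integrable_prod_integral_prod (starRelation T) hU).const_mul _

theorem integral_starDefect (n : ℕ) {U : Graphon} (hU : Measurable fun z : I × I => U z.1 z.2) :
    ∫ x, starDefect n U x = ∑ T ∈ (Finset.univ : Finset (Fin n × Fin 2)).powerset,
      (-1) ^ (Finset.univ \ T).card *
        density (bipartiteGraph (starRelation T)) U := by
  classical
  simp only [starDefect_eq_sum]
  rw [integral_finsetSum _ fun T _ =>
    (integrable_prod_integral_prod (starRelation T) hU).const_mul _]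
  refine Finset.sum_congr rfl fun T _ => ?_
  rw [integral_const_mul, density_bipartiteGraph _ _ hU]

/-- The largest leaf has the smallest neighbourhood, which is therefore the common neighbourhood of
all leaves. -/
theorem starDefect_ofPolynomial {p : MvPolynomial (Fin 2) ℝ} {hp : p.IsSymmetric}
    (hanti : Antitone (fun z : I × I => MvPolynomial.eval ![(z.1 : ℝ), (z.2 : ℝ)] p))
    {n : ℕ} (hn : n ≠ 0) (x : Fin n → I) : starDefect n (ofPolynomial p hp) x = 0 := by
  have : NeZero n := ⟨hn⟩
  obtain ⟨i, hi⟩ := Finite.exists_max x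
  refine Finset.prod_eq_zero (Finset.mem_univ (i, 0)) (sub_eq_zero.2 ?_)
  refine integral_congr_ae (Filter.Eventually.of_forall fun y => ?_)
  dsimp only
  rcases ofPolynomial_eq_zero_or_one p hp (x i) y with h | h
  · rw [h]
    exact Finset.prod_eq_zero (Finset.mem_univ i) h
  · rw [h]
    exact Finset.prod_eq_one fun a _ => ofPolynomial_eq_one_of_le hanti (hi a) h

/-! ### Finite forcibility -/

theorem density_eq_of_card_le {U W : Graphon} {M : ℕ}
    (h : ∀ N, N ≤ M → ∀ F : SimpleGraph (Fin N), density F U = density F W) {V : Type*} [Fintype V]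
    (hV : Fintype.card V ≤ M) (F : SimpleGraph V) : density F U = density F W := by
  rw [density_of_iso (SimpleGraph.Iso.map (Fintype.equivFin V) F),
    density_of_iso (SimpleGraph.Iso.map (Fintype.equivFin V) F)]
  exact h _ hV _

theorem finitelyForcibleIn_of_forall_le {A : Set Graphon} {W : Graphon} (hW : W ∈ A) (M : ℕ)
    (h : ∀ U ∈ A, (∀ N, N ≤ M → ∀ F : SimpleGraph (Fin N), density F U = density F W) →
      WeaklyIsomorphic U W) : FinitelyForcibleIn A W := by
  classical
  let e := Fintype.equivFin (Σ N : Fin (M + 1), SimpleGraph (Fin N))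
  refine ⟨hW, _, fun i => (e.symm i).1, fun i => (e.symm i).2, fun U hU hd => h U hU ?_⟩
  intro N hN F
  have key : ∀ s : Σ N : Fin (M + 1), SimpleGraph (Fin N), density s.2 U = density s.2 W :=
    e.symm.surjective.forall.2 hd
  exact key ⟨⟨N, Nat.lt_succ_of_le hN⟩, F⟩

theorem isNested_of_density_eq_ofPolynomial {p : MvPolynomial (Fin 2) ℝ} {hp : p.IsSymmetric}
    (hanti : Antitone (fun z : I × I => MvPolynomial.eval ![(z.1 : ℝ), (z.2 : ℝ)] p))
    {U : Graphon} (hU : Measurable fun z : I × I => U z.1 z.2)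
    (h : ∀ N, N ≤ 12 → ∀ F : SimpleGraph (Fin N), density F U = density F (ofPolynomial p hp)) :
    U.IsNested := by
  refine isNested_of_star_relations hU fun n hn2 hn4 => ?_
  -- There are `n` leaves and `2 * n` centres, and `n ≤ 4`.
  have hcard : Fintype.card (Fin n ⊕ Fin n × Fin 2) ≤ 12 := by
    simp only [Fintype.card_sum, Fintype.card_prod, Fintype.card_fin]
    omega
  have h0 : ∫ x, starDefect n U x = 0 := by
    rw [integral_starDefect n hU]
    simp only [density_eq_of_card_le h hcard]
    rw [← integral_starDefect n (measurable_ofPolynomial p hp)]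
    simp only [starDefect_ofPolynomial hanti (show n ≠ 0 by omega), integral_zero]
  rw [integral_eq_zero_iff_of_nonneg (starDefect_nonneg n U) (integrable_starDefect n hU)] at h0
  filter_upwards [h0] with x hx
  obtain ⟨j, _, hj⟩ := Finset.prod_eq_zero_iff.1 hx
  exact ⟨j.1, sub_eq_zero.1 hj⟩

theorem finitelyForcibleIn_ofPolynomial (p : MvPolynomial (Fin 2) ℝ) (hp : p.IsSymmetric)
    (hanti : Antitone (fun z : I × I => MvPolynomial.eval ![(z.1 : ℝ), (z.2 : ℝ)] p)) :
    FinitelyForcibleIn Set.univ (ofPolynomial p hp) := by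
  -- Graphs on 12 nodes force nestedness; `2 * (deg p + 1)` nodes accommodate every required
  -- complete bipartite graph.
  refine finitelyForcibleIn_of_forall_le (Set.mem_univ _) (max 12 (2 * (p.totalDegree + 1)))
    fun U _ hd => ?_
  obtain ⟨U', hU', hae⟩ := U.exists_measurable_ae_eq
  have hiso := weaklyIsomorphic_of_ae hae
  have hd' : ∀ N, N ≤ max 12 (2 * (p.totalDegree + 1)) → ∀ F : SimpleGraph (Fin N),
      density F U' = density F (ofPolynomial p hp) := fun N hN F =>
    (hiso N F).symm.trans (hd N hN F)
  refine hiso.trans ((isNested_of_density_eq_ofPolynomial hanti hU' fun N hN =>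
    hd' N (hN.trans (le_max_left _ _))).weaklyIsomorphic_ofPolynomial hU' p hp hanti ?_)
  intro a b ha hb
  refine density_eq_of_card_le hd' (le_max_of_le_right ?_) _
  simp only [Fintype.card_sum, Fintype.card_fin]
  omega

theorem weaklyIsomorphic_ofPolynomial_of_labeledDensity (p : MvPolynomial (Fin 2) ℝ)
    (hp : p.IsSymmetric)
    (hanti : Antitone (fun z : I × I => MvPolynomial.eval ![(z.1 : ℝ), (z.2 : ℝ)] p))
    {U : Graphon} (hC4 : ∀ᵐ x : Fin 4 → I, labeledDensity coloredC4 U x = 0)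
    (hdens : ∀ a b : ℕ, a ≤ p.totalDegree + 1 → b ≤ p.totalDegree + 1 →
      density (completeBipartiteGraph (Fin a) (Fin b)) U =
        density (completeBipartiteGraph (Fin a) (Fin b)) (ofPolynomial p hp)) :
    WeaklyIsomorphic U (ofPolynomial p hp) := by
  obtain ⟨U', hU', hae⟩ := U.exists_measurable_ae_eq
  have hiso := weaklyIsomorphic_of_ae hae
  have hnest : U'.IsNested := isNested_of_labeledDensity_eq_zero <| by
    filter_upwards [hC4, labeledDensity_congr_ae hae coloredC4] with x h1 h2
    rw [← h2, h1]
  exact hiso.trans (hnest.weaklyIsomorphic_ofPolynomial hU' p hp hanti fun a b ha hb =>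
    (hiso.density_eq _).symm.trans (hdens a b ha hb))

theorem finitelyForcibleIn_half : FinitelyForcibleIn Set.univ half := by
  let p : MvPolynomial (Fin 2) ℝ := 1 - (MvPolynomial.X 0 + MvPolynomial.X 1)
  have hp : p.IsSymmetric := by
    intro e
    have h : MvPolynomial.X (e 0) + MvPolynomial.X (e 1) =
        (MvPolynomial.X 0 + MvPolynomial.X 1 : MvPolynomial (Fin 2) ℝ) := by
      have := Equiv.sum_comp e (fun i => (MvPolynomial.X i : MvPolynomial (Fin 2) ℝ))
      simpa [Fin.sum_univ_two] using this
    simp only [p, map_sub, map_add, map_one, MvPolynomial.rename_X, h]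
  have heval : ∀ x y : ℝ, MvPolynomial.eval ![x, y] p = 1 - (x + y) := fun x y => by simp [p]
  have hanti : Antitone (fun z : I × I => MvPolynomial.eval ![(z.1 : ℝ), (z.2 : ℝ)] p) := by
    intro z w hzw
    have h1 : (z.1 : ℝ) ≤ w.1 := hzw.1
    have h2 : (z.2 : ℝ) ≤ w.2 := hzw.2
    simp only [heval]
    linarith
  have heq : half = ofPolynomial p hp := by
    unfold half ofPolynomial
    congr 1
    funext x y
    simp only [heval, sub_nonneg]
  rw [heq]
  exact finitelyForcibleIn_ofPolynomial p hp hanti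

end Graphon

theorem theorem5p1 :
    (∀ (p : MvPolynomial (Fin 2) ℝ) (hp : p.IsSymmetric),
      Antitone (fun z : unitInterval × unitInterval =>
        MvPolynomial.eval ![(z.1 : ℝ), (z.2 : ℝ)] p) →
      Graphon.FinitelyForcibleIn Set.univ (Graphon.ofPolynomial p hp) ∧
      (∀ᵐ x : Fin 4 → unitInterval,
        Graphon.labeledDensity Graphon.coloredC4 (Graphon.ofPolynomial p hp) x = 0) ∧
      (∀ U : Graphon,
        (∀ᵐ x : Fin 4 → unitInterval, Graphon.labeledDensity Graphon.coloredC4 U x = 0) →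
        (∀ a b : ℕ, a ≤ p.totalDegree + 1 → b ≤ p.totalDegree + 1 →
          Graphon.density (completeBipartiteGraph (Fin a) (Fin b)) U =
            Graphon.density (completeBipartiteGraph (Fin a) (Fin b))
              (Graphon.ofPolynomial p hp)) →
        Graphon.WeaklyIsomorphic U (Graphon.ofPolynomial p hp))) ∧
    Graphon.FinitelyForcibleIn Set.univ Graphon.half :=
  ⟨fun p hp hanti => ⟨Graphon.finitelyForcibleIn_ofPolynomial p hp hanti,
    Filter.Eventually.of_forall (Graphon.labeledDensity_coloredC4_ofPolynomial p hp hanti),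
    fun _ hC4 hdens =>
      Graphon.weaklyIsomorphic_ofPolynomial_of_labeledDensity p hp hanti hC4 hdens⟩,
    Graphon.finitelyForcibleIn_half⟩
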